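/- Let $p$ be a prime, $e, m \ge 1$ integers, $q = p^e$, and let $\mathbb{F}_{q^m}$ be the finite field with $q^m$ elements. Let $f \in \mathbb{F}_{q^m}[x_1,\ldots,x_k]$ be a polynomial of (total) degree $d \ge 1$, and let $N(f = y^q - y)$ denote the number of solutions $(x_1,\ldots,x_k,y) \in \mathbb{F}_{q^m}^{k+1}$ of the Artin–Schreier type equation $f(x_1,\ldots,x_k) = y^q - y$. Then $$\nu_p\bigl(N(f = y^q - y)\bigr) \ \ge\ \left\lceil \frac{em(q-1)}{q^m-1} \left\lceil \frac{k(q^m-1)}{d(q-1)} \right\rceil \right\rceil,$$ where $\nu_p$ is the $p$-adic valuation, with $\nu_p(0) = \infty$. -/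

import Mathlib

/-- The number `N(f = y^q - y)` of solutions `(x_1, …, x_k, y) ∈ F^(k+1)` of the
Artin–Schreier type equation `f(x_1, …, x_k) = y^q - y`. -/
noncomputable def artinSchreierCount {F : Type*} [Field F] {k : ℕ}
    (f : MvPolynomial (Fin k) F) (q : ℕ) : ℕ :=
  Nat.card {z : (Fin k → F) × F // MvPolynomial.eval z.1 f = z.2 ^ q - z.2}

/-!
Let `ζ` be a primitive `p`-th root of unity in the ring of integers of `ℂ_[p]`, so that `p` is
associated to `(ζ - 1) ^ (p - 1)`, and let `χ` be a Teichmüller character of `F`, which has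
`p ^ h` elements with `h = e * m`. For the additive character `ψ x = ζ ^ Tr x`, the sums
`∑ x, ψ (c * f x)` over the `c` with `c ^ q = c` add up to the number of solutions.

Expand `ψ` in powers of `χ`. By Stickelberger's theorem the coefficient of `χ ^ r` is divisible by
`(ζ - 1) ^ s r`, where `s r` is the sum of the base-`p` digits of `r`. By orthogonality the term
attached to a choice of one exponent `r i` per monomial of `f` vanishes unless `q - 1` divides
`∑ i, r i` and `p ^ h - 1` divides the `χ`-exponent of every variable. Comparing degrees bounds
`∑ i, r i` from below. The congruences are stable under cyclic rotation of the digits of all the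
`r i`, and averaging the bound over the `h` rotations turns it into a bound on `∑ i, s (r i)`.
-/

section Development

open Finset

section Digits

variable {p : ℕ}

theorem sum_digits_eq_mod_add_sum_digits_div (hp : 1 < p) (r : ℕ) :
    (p.digits r).sum = r % p + (p.digits (r / p)).sum := by
  rcases r.eq_zero_or_pos with rfl | hr
  · simp
  · rw [Nat.digits_def' hp hr, List.sum_cons]

theorem sum_digits_eq_sum_range (hp : 1 < p) {h r : ℕ} (hr : r < p ^ h) :
    (p.digits r).sum = ∑ j ∈ range h, r / p ^ j % p := by
  induction h generalizing r with
  | zero => simp [Nat.lt_one_iff.1 hr]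
  | succ h ih =>
    have hdiv : r / p < p ^ h := Nat.div_lt_of_lt_mul (by rwa [← pow_succ'])
    rw [sum_digits_eq_mod_add_sum_digits_div hp, ih hdiv, sum_range_succ', pow_zero, Nat.div_one,
      add_comm]
    simp only [Nat.div_div_eq_div_mul, ← pow_succ']

theorem sum_digits_pow_sub_one_sub_add (hp : 1 < p) {h r : ℕ} (hr : r < p ^ h) :
    (p.digits (p ^ h - 1 - r)).sum + (p.digits r).sum = (p - 1) * h := by
  induction h generalizing r with
  | zero => simp [Nat.lt_one_iff.1 hr]
  | succ h ih =>
    have hdiv : r / p < p ^ h := Nat.div_lt_of_lt_mul (by rwa [← pow_succ'])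
    have hmod : r % p < p := Nat.mod_lt _ (by lia)
    have hcompl : p ^ (h + 1) - 1 - r = p * (p ^ h - 1 - r / p) + (p - 1 - r % p) := by
      zify [show 1 ≤ p ^ (h + 1) by lia, show r ≤ p ^ (h + 1) - 1 by lia, hp.le,
        show r / p ≤ p ^ h - 1 by lia, show 1 ≤ p ^ h by lia, show r % p ≤ p - 1 by lia]
      linear_combination Int.emod_add_mul_ediv (r : ℤ) p
    have hlt : p - 1 - r % p < p := by lia
    rw [sum_digits_eq_mod_add_sum_digits_div hp r, sum_digits_eq_mod_add_sum_digits_div hp,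
      hcompl, Nat.mul_add_mod, Nat.mod_eq_of_lt hlt, Nat.mul_add_div (by lia),
      Nat.div_eq_of_lt hlt, add_zero, Nat.mul_add_one, ← ih hdiv]
    lia

end Digits

/-- For `r < p ^ h`, the cyclic rotation by `j ≤ h` places of the `h` base-`p` digits of `r`: the
lowest `j` digits become the highest ones. -/
def digitRotate (p h j r : ℕ) : ℕ := r / p ^ j + r % p ^ j * p ^ (h - j)

section DigitRotate

variable {p h j r : ℕ}

theorem pow_mul_digitRotate (hp : 0 < p) (hj : j ≤ h) (r : ℕ) :
    p ^ j * digitRotate p h j r = r + r % p ^ j * (p ^ h - 1) := by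
  have hsplit : p ^ j * p ^ (h - j) = p ^ h - 1 + 1 := by
    rw [← pow_add, Nat.add_sub_cancel' hj, Nat.sub_add_cancel (Nat.one_le_pow _ _ hp)]
  calc p ^ j * digitRotate p h j r
      = p ^ j * (r / p ^ j) + r % p ^ j * (p ^ j * p ^ (h - j)) := by rw [digitRotate]; ring
    _ = p ^ j * (r / p ^ j) + r % p ^ j + r % p ^ j * (p ^ h - 1) := by rw [hsplit]; ring
    _ = r + r % p ^ j * (p ^ h - 1) := by rw [Nat.div_add_mod]

theorem mul_digitRotate_succ (hp : 0 < p) (hj : j < h) (r : ℕ) :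
    p * digitRotate p h (j + 1) r = digitRotate p h j r + r / p ^ j % p * (p ^ h - 1) := by
  refine Nat.eq_of_mul_eq_mul_left (pow_pos hp j) ?_
  rw [← mul_assoc, ← pow_succ, pow_mul_digitRotate hp hj, mul_add, pow_mul_digitRotate hp hj.le,
    Nat.mod_pow_succ]
  ring

theorem digitRotate_eq_zero_iff (hp : 0 < p) (hj : j ≤ h) : digitRotate p h j r = 0 ↔ r = 0 := by
  refine ⟨fun hrot => ?_, fun hr => by simp [digitRotate, hr]⟩
  have hmul := pow_mul_digitRotate hp hj r
  rw [hrot, mul_zero] at hmul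
  exact Nat.eq_zero_of_add_eq_zero_right hmul.symm

theorem sub_one_mul_sum_digitRotate (hp : 1 < p) (hr : r < p ^ h) :
    (p - 1) * ∑ j ∈ range h, digitRotate p h j r = (p ^ h - 1) * (p.digits r).sum := by
  have hsucc : p * ∑ j ∈ range h, digitRotate p h (j + 1) r =
      ∑ j ∈ range h, digitRotate p h j r + (p ^ h - 1) * (p.digits r).sum := by
    rw [sum_digits_eq_sum_range hp hr, mul_sum, mul_sum, ← sum_add_distrib]
    refine sum_congr rfl fun j hj => ?_
    rw [mul_digitRotate_succ (by lia) (mem_range.1 hj), mul_comm (p ^ h - 1)]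
  have hcyclic : ∑ j ∈ range h, digitRotate p h (j + 1) r = ∑ j ∈ range h, digitRotate p h j r := by
    have hends : digitRotate p h 0 r = digitRotate p h h r := by
      simp [digitRotate, Nat.div_eq_of_lt hr, Nat.mod_eq_of_lt hr, Nat.mod_one]
    have := (sum_range_succ' (digitRotate p h · r) h).symm.trans
      (sum_range_succ (digitRotate p h · r) h)
    lia
  rw [Nat.sub_mul, one_mul, ← hcyclic, hsucc, hcyclic, Nat.add_sub_cancel_left]

theorem dvd_sum_mul_digitRotate_iff (hp : 0 < p) (hj : j ≤ h) {m : ℕ} (hm : m ∣ p ^ h - 1)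
    {I : Type*} [Fintype I] (b r : I → ℕ) :
    m ∣ ∑ i, b i * digitRotate p h j (r i) ↔ m ∣ ∑ i, b i * r i := by
  have hcop : (p ^ h - 1).Coprime (p ^ h) :=
    (Nat.coprime_self_sub_left (Nat.one_le_pow h p hp)).2 (Nat.coprime_one_left _)
  have hmul : p ^ j * ∑ i, b i * digitRotate p h j (r i) =
      ∑ i, b i * r i + (p ^ h - 1) * ∑ i, b i * (r i % p ^ j) := by
    simp_rw [mul_sum, ← sum_add_distrib, mul_left_comm (p ^ j), pow_mul_digitRotate hp hj]
    exact sum_congr rfl fun i _ => by ring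
  rw [← ((hcop.coprime_dvd_left hm).coprime_dvd_right (pow_dvd_pow p hj)).dvd_mul_left, hmul,
    Nat.dvd_add_left (hm.mul_right _)]

end DigitRotate

section Weights

variable {I σ : Type*} [Fintype I] [Fintype σ] {D : I → σ → ℕ} {r : I → ℕ} {n d Q : ℕ}

/- A column `l` of sum zero contributes no degree and is charged `n` instead; in the character sum
such a variable contributes a factor `|F|`, which pays for the charge. -/
theorem mul_ceilDiv_le_sum_add_card_mul (hn : 0 < n) (hd : 0 < d) (hD : ∀ i, ∑ l, D i l ≤ d)
    (hQn : Q ∣ n) (hQ : Q ∣ ∑ i, r i) (hdvd : ∀ l, n ∣ ∑ i, D i l * r i) :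
    Q * (Fintype.card σ * n ⌈/⌉ (d * Q)) ≤ ∑ i, r i + #{l | ∑ i, D i l * r i = 0} * n := by
  have hcolumn (l : σ) : n ≤ ∑ i, D i l * r i + if ∑ i, D i l * r i = 0 then n else 0 := by
    split_ifs with hzero
    · exact Nat.le_add_left _ _
    · exact Nat.le_of_dvd (Nat.pos_of_ne_zero hzero) (hdvd l)
  have htotal : ∑ l, ∑ i, D i l * r i ≤ d * ∑ i, r i := by
    rw [sum_comm, mul_sum]
    exact sum_le_sum fun i _ => by rw [← sum_mul]; exact Nat.mul_le_mul_right _ (hD i)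
  have hcard : Fintype.card σ * n ≤ d * (∑ i, r i + #{l | ∑ i, D i l * r i = 0} * n) :=
    calc Fintype.card σ * n = ∑ _l : σ, n := by simp
      _ ≤ ∑ l, (∑ i, D i l * r i + if ∑ i, D i l * r i = 0 then n else 0) :=
        sum_le_sum fun l _ => hcolumn l
      _ = ∑ l, ∑ i, D i l * r i + #{l | ∑ i, D i l * r i = 0} * n := by
        rw [sum_add_distrib, ← sum_filter, sum_const, smul_eq_mul]
      _ ≤ _ := by
        rw [mul_add]
        exact Nat.add_le_add htotal (Nat.le_mul_of_pos_left _ hd)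
  obtain ⟨b, hb⟩ := dvd_add hQ (hQn.mul_left #{l | ∑ i, D i l * r i = 0})
  rw [hb, ← mul_assoc] at hcard
  rw [hb]
  exact Nat.mul_le_mul_left Q
    ((ceilDiv_le_iff_le_mul (Nat.mul_pos hd (Nat.pos_of_dvd_of_pos hQn hn))).2 hcard)

variable {p h : ℕ}

theorem mul_ceilDiv_le_sum_digitRotate_add_card_mul {j : ℕ} (hp : 1 < p) (hj : j < h) (hd : 0 < d)
    (hD : ∀ i, ∑ l, D i l ≤ d) (hQn : Q ∣ p ^ h - 1) (hQ : Q ∣ ∑ i, r i)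
    (hdvd : ∀ l, p ^ h - 1 ∣ ∑ i, D i l * r i) :
    Q * (Fintype.card σ * (p ^ h - 1) ⌈/⌉ (d * Q)) ≤
      ∑ i, digitRotate p h j (r i) + #{l | ∑ i, D i l * r i = 0} * (p ^ h - 1) := by
  have hn : 0 < p ^ h - 1 := Nat.sub_pos_of_lt (Nat.one_lt_pow (by lia) hp)
  have hzero (l : σ) : ∑ i, D i l * digitRotate p h j (r i) = 0 ↔ ∑ i, D i l * r i = 0 := by
    simp only [sum_eq_zero_iff, mul_eq_zero, digitRotate_eq_zero_iff (by lia : 0 < p) hj.le]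
  have hrot := mul_ceilDiv_le_sum_add_card_mul (r := fun i => digitRotate p h j (r i)) hn hd hD hQn
    (by simpa using (dvd_sum_mul_digitRotate_iff (by lia) hj.le hQn 1 r).2 (by simpa using hQ))
    fun l => (dvd_sum_mul_digitRotate_iff (by lia) hj.le dvd_rfl (D · l) r).2 (hdvd l)
  simpa only [hzero] using hrot

theorem mul_ceilDiv_le_mul_sum_digits_add_card_mul (hp : 1 < p) (hd : 0 < d)
    (hD : ∀ i, ∑ l, D i l ≤ d) (hr : ∀ i, r i < p ^ h) (hQn : Q ∣ p ^ h - 1) (hQ : Q ∣ ∑ i, r i)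
    (hdvd : ∀ l, p ^ h - 1 ∣ ∑ i, D i l * r i) :
    (p - 1) * (h * (Q * (Fintype.card σ * (p ^ h - 1) ⌈/⌉ (d * Q)))) ≤ (p ^ h - 1) *
      (∑ i, (p.digits (r i)).sum + (p - 1) * h * #{l | ∑ i, D i l * r i = 0}) := by
  have hsum := card_nsmul_le_sum (range h) _ _ fun j hj =>
    mul_ceilDiv_le_sum_digitRotate_add_card_mul hp (mem_range.1 hj) hd hD hQn hQ hdvd
  rw [card_range, smul_eq_mul] at hsum
  refine (Nat.mul_le_mul_left (p - 1) hsum).trans_eq ?_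
  rw [sum_add_distrib, sum_comm, mul_add, mul_sum,
    sum_congr rfl fun i _ => sub_one_mul_sum_digitRotate hp (hr i), ← mul_sum, sum_const,
    card_range, smul_eq_mul]
  ring

end Weights

section GaussSum

variable {F R : Type*} [Field F] [Fintype F] [CommRing R] {ψ : AddChar F R}
  {p : ℕ} [hp : Fact p.Prime] [CharP F p]

theorem gaussSum_pow_char (hψp : ∀ x, ψ (x ^ p) = ψ x) (χ : MulChar F R) :
    gaussSum (χ ^ p) ψ = gaussSum χ ψ :=
  Fintype.sum_bijective (frobenius F p) (bijective_frobenius F p) _ _ fun x => by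
    rw [frobenius_def, hψp, MulChar.pow_apply' _ hp.out.ne_zero, map_pow]

variable [IsDomain R]

theorem gaussSum_mul_dvd_mul (hψ : ψ ≠ 1) (χ φ : MulChar F R) :
    gaussSum (χ * φ) ψ ∣ gaussSum χ ψ * gaussSum φ ψ := by
  by_cases hχφ : χ * φ = 1
  · rw [hχφ, gaussSum_one_left hψ]
    exact isUnit_one.neg.dvd
  · exact ⟨_, (jacobiSum_mul_nontrivial hχφ ψ).symm⟩

theorem gaussSum_pow_dvd_pow (hψ : ψ ≠ 1) (χ : MulChar F R) (a : ℕ) :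
    gaussSum (χ ^ a) ψ ∣ gaussSum χ ψ ^ a := by
  induction a with
  | zero =>
    rw [pow_zero, gaussSum_one_left hψ]
    exact isUnit_one.neg.dvd
  | succ a ih =>
    rw [pow_succ, pow_succ]
    exact (gaussSum_mul_dvd_mul hψ _ _).trans (mul_dvd_mul_right ih _)

/- By Frobenius invariance the base-`p` shift `r ↦ p * r` is free, so only the digits count. -/
theorem gaussSum_pow_dvd_pow_sum_digits (hψ : ψ ≠ 1) (hψp : ∀ x, ψ (x ^ p) = ψ x)
    (χ : MulChar F R) (r : ℕ) : gaussSum (χ ^ r) ψ ∣ gaussSum χ ψ ^ (p.digits r).sum := by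
  induction r using Nat.strong_induction_on with
  | _ r ih =>
    rcases r.eq_zero_or_pos with rfl | hr
    · simpa using gaussSum_pow_dvd_pow hψ χ 0
    have hsplit : χ ^ r = χ ^ (r % p) * (χ ^ (r / p)) ^ p := by
      rw [← pow_mul, ← pow_add, mul_comm, Nat.mod_add_div]
    rw [hsplit, sum_digits_eq_mod_add_sum_digits_div hp.out.one_lt, pow_add]
    refine (gaussSum_mul_dvd_mul hψ _ _).trans (mul_dvd_mul (gaussSum_pow_dvd_pow hψ χ _) ?_)
    rw [gaussSum_pow_char hψp]
    exact ih _ (Nat.div_lt_self hr hp.out.one_lt)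

end GaussSum

section TraceCharacter

variable {p : ℕ} [hp : Fact p.Prime] (F : Type*) [Field F] [Algebra (ZMod p) F] {R : Type*}
  [CommRing R] {ζ : R}

/-- The additive character `x ↦ ζ ^ Tr(x)` of a finite field of characteristic `p`, where `Tr` is
the trace down to the prime field. -/
noncomputable def traceAddChar (hζ : ζ ^ p = 1) : AddChar F R :=
  (AddChar.zmodChar p hζ).compAddMonoidHom (Algebra.trace (ZMod p) F).toAddMonoidHom

theorem traceAddChar_apply (hζ : ζ ^ p = 1) (x : F) :
    traceAddChar F hζ x = ζ ^ (Algebra.trace (ZMod p) F x).val := rfl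

variable [Finite F]

theorem traceAddChar_ne_one (hζ : ζ ^ p = 1) (hζ1 : ζ ≠ 1) : traceAddChar F hζ ≠ 1 := by
  intro htriv
  obtain ⟨x, hx⟩ := Algebra.trace_surjective (ZMod p) F 1
  have hval := traceAddChar_apply F hζ x
  rw [htriv, AddChar.one_apply, hx, ZMod.val_one, pow_one] at hval
  exact hζ1 hval.symm

theorem traceAddChar_pow_char (hζ : ζ ^ p = 1) (x : F) :
    traceAddChar F hζ (x ^ p) = traceAddChar F hζ x := by
  have htrace :=
    Algebra.trace_eq_of_algEquiv (FiniteField.frobeniusAlgEquivOfAlgebraic (ZMod p) F) x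
  rw [FiniteField.coe_frobeniusAlgEquivOfAlgebraic, ZMod.card] at htrace
  rw [traceAddChar_apply, traceAddChar_apply, htrace]

theorem traceAddChar_pow_char_pow (hζ : ζ ^ p = 1) (e : ℕ) (x : F) :
    traceAddChar F hζ (x ^ p ^ e) = traceAddChar F hζ x := by
  induction e with
  | zero => rw [pow_zero, pow_one]
  | succ e ih => rw [pow_succ, pow_mul, traceAddChar_pow_char, ih]

end TraceCharacter

section Stickelberger

theorem sum_inv_mul_algebraMap_trace (p : ℕ) [hp : Fact p.Prime] (F : Type*) [Field F] [Fintype F]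
    [Algebra (ZMod p) F] :
    ∑ x : F, x⁻¹ * algebraMap (ZMod p) F (Algebra.trace (ZMod p) F x) = -1 := by
  classical
  have hcard : Fintype.card F = p ^ Module.finrank (ZMod p) F := by
    rw [Module.card_eq_pow_finrank (K := ZMod p), ZMod.card]
  obtain ⟨h, hh⟩ := Nat.exists_eq_add_one_of_ne_zero
    (Module.finrank_pos (R := ZMod p) (M := F)).ne'
  rw [hh] at hcard
  have hzero : ∑ x : F, x⁻¹ * x = -1 := by
    have hterm (x : F) : x⁻¹ * x = 1 - if x = 0 then 1 else 0 := by
      split_ifs with hx <;> simp [hx]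
    simp [hterm]
  have hsucc (j : ℕ) (hj : j < h) : ∑ x : F, x⁻¹ * x ^ p ^ (j + 1) = 0 := by
    have hpj : 1 < p ^ (j + 1) := Nat.one_lt_pow j.succ_ne_zero hp.out.one_lt
    have hlt : p ^ (j + 1) < p ^ (h + 1) := Nat.pow_lt_pow_right hp.out.one_lt (by lia)
    rw [← FiniteField.sum_pow_lt_card_sub_one (K := F) (p ^ (j + 1) - 1) (by lia)]
    refine sum_congr rfl fun x _ => ?_
    rcases eq_or_ne x 0 with rfl | hx
    · rw [inv_zero, zero_mul, zero_pow (by lia)]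
    · rw [pow_sub₀ _ hx hpj.le, pow_one, mul_comm]
  simp_rw [FiniteField.algebraMap_trace_eq_sum_pow, mul_sum, Nat.card_zmod]
  rw [sum_comm, hh, sum_range_succ', sum_eq_zero fun j hj => hsucc j (mem_range.1 hj), zero_add]
  simpa using hzero

variable {p : ℕ} [hp : Fact p.Prime] {F : Type*} [Field F] [Fintype F] [Algebra (ZMod p) F]
  {R k : Type*} [CommRing R] [Field k] {ζ : R}

theorem exists_gaussSum_inv_traceAddChar_eq_mul [IsDomain R] (hζ : ζ ^ p = 1) {π : R →+* k}
    (hπ : π ζ = 1) {φ : F →+* k} {χ : MulChar F R} (hχ : ∀ x, π (χ x) = φ x) (hχ1 : χ ≠ 1) :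
    ∃ A, gaussSum χ⁻¹ (traceAddChar F hζ) = (ζ - 1) * A ∧ π A = -1 := by
  let t (x : F) : ℕ := (Algebra.trace (ZMod p) F x).val
  refine ⟨∑ x, χ⁻¹ x * ∑ i ∈ range (t x), ζ ^ i, ?_, ?_⟩
  · rw [← sub_zero (gaussSum _ _), ← MulChar.sum_eq_zero_of_ne_one (inv_ne_one.2 hχ1), gaussSum,
      ← sum_sub_distrib, mul_sum]
    refine sum_congr rfl fun x _ => ?_
    rw [mul_left_comm, mul_geom_sum, traceAddChar_apply, mul_sub_one]
  · rw [← map_one φ, ← map_neg, ← sum_inv_mul_algebraMap_trace p F, map_sum, map_sum]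
    refine sum_congr rfl fun x _ => ?_
    have htrace : algebraMap (ZMod p) F (Algebra.trace (ZMod p) F x) = t x := by
      rw [← map_natCast (algebraMap (ZMod p) F), ZMod.natCast_rightInverse]
    simp [htrace, MulChar.inv_apply', hχ, hπ]

theorem associated_sub_one_pow_natCast [IsDomain R] (hζ : IsPrimitiveRoot ζ p) :
    Associated ((ζ - 1) ^ (p - 1)) (p : R) := by
  obtain ⟨n, rfl⟩ := Nat.exists_eq_add_one_of_ne_zero hp.out.ne_zero
  rw [Nat.add_sub_cancel, Nat.cast_add_one, ← hζ.prod_one_sub_pow_eq_order, ← card_range n,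
    ← prod_const, card_range]
  refine Associated.prod _ _ _ fun j hj => ?_
  rw [← neg_sub (ζ ^ (j + 1)), Associated.neg_right_iff]
  exact hζ.associated_sub_one_pow_sub_one_of_coprime
    (Nat.coprime_of_lt_prime j.succ_ne_zero (by simpa using hj) hp.out).symm

end Stickelberger

theorem injective_of_map_apply_eq {F R k : Type*} [Field F] [CommRing R] [Field k] {π : R →+* k}
    {φ : F →+* k} {χ : MulChar F R} (hχ : ∀ x, π (χ x) = φ x) : Function.Injective χ :=
  fun x y hxy => φ.injective (by rw [← hχ, ← hχ, hxy])

section LocalRing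

open IsLocalRing

variable {p : ℕ} [hp : Fact p.Prime] {F : Type*} [Field F] [Fintype F] {R : Type*} [CommRing R]

theorem orderOf_eq_card_sub_one_of_injective {χ : MulChar F R} (hχ : Function.Injective χ) :
    orderOf χ = Fintype.card F - 1 := by
  classical
  refine Nat.dvd_antisymm χ.orderOf_dvd_card_sub_one ?_
  obtain ⟨g, hg⟩ := IsCyclic.exists_generator (α := Fˣ)
  rw [← Fintype.card_units, ← Nat.card_eq_fintype_card, ← orderOf_eq_card_of_forall_mem_zpowers hg]
  refine orderOf_dvd_of_pow_eq_one (Units.ext (hχ ?_))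
  rw [Units.val_pow_eq_pow_val, map_pow, ← MulChar.pow_apply_coe, pow_orderOf_eq_one,
    MulChar.one_apply_coe, Units.val_one, map_one]

variable [IsDomain R]

theorem associated_gaussSum_mul_gaussSum_inv {χ : MulChar F R} (hχ : χ ≠ 1) {ψ : AddChar F R}
    (hψ : ψ ≠ 1) : Associated (gaussSum χ ψ * gaussSum χ⁻¹ ψ) (Fintype.card F : R) := by
  rw [← gaussSum_mul_gaussSum_eq_card hχ (AddChar.IsPrimitive.of_ne_one hψ),
    ← mul_gaussSum_inv_eq_gaussSum χ⁻¹ ψ]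
  exact Associated.mul_left _ (associated_unit_mul_left _ _ ((isUnit_neg_one (α := F)).map χ⁻¹))

variable [IsLocalRing R] [CharP (ResidueField R) p] [Algebra (ZMod p) F] {ζ : R}
  {χ : MulChar F R} {φ : F →+* ResidueField R}

theorem associated_gaussSum_inv_traceAddChar (hζ : ζ ^ p = 1) (hχ : ∀ x, residue R (χ x) = φ x)
    (hχ1 : χ ≠ 1) : Associated (gaussSum χ⁻¹ (traceAddChar F hζ)) (ζ - 1) := by
  have hres : residue R ζ = 1 := frobenius_inj (ResidueField R) p <| by
    rw [frobenius_def, frobenius_def, ← map_pow, hζ, map_one, one_pow]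
  obtain ⟨A, hgauss, hA⟩ := exists_gaussSum_inv_traceAddChar_eq_mul hζ hres hχ hχ1
  rw [hgauss]
  exact associated_mul_unit_left _ _ ((residue_ne_zero_iff_isUnit A).1 (by simp [hA]))

/- Submultiplicativity of Gauss sums bounds valuations from above only. Applied to the complementary
exponent `p ^ h - 1 - r` it yields the lower bound, because the two Gauss sums have product `|F|`
up to a unit and the two digit sums add up to `(p - 1) * h`. -/
theorem sub_one_pow_sum_digits_dvd_gaussSum (hζ : IsPrimitiveRoot ζ p)
    (hχ : ∀ x, residue R (χ x) = φ x) {h : ℕ} (hF : Fintype.card F = p ^ h) {r : ℕ} (hr0 : 0 < r)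
    (hr : r < p ^ h - 1) :
    (ζ - 1) ^ (p.digits r).sum ∣ gaussSum (χ⁻¹ ^ r) (traceAddChar F hζ.pow_eq_one) := by
  have hζ1 : ζ - 1 ≠ 0 := sub_ne_zero.2 (hζ.ne_one hp.out.one_lt)
  have hinj := injective_of_map_apply_eq hχ
  have hord : orderOf χ⁻¹ = p ^ h - 1 := by
    rw [orderOf_inv, orderOf_eq_card_sub_one_of_injective hinj, hF]
  have hχ1 : χ ≠ 1 := fun h1 => by simp [h1] at hord; lia
  have hψ1 := traceAddChar_ne_one F hζ.pow_eq_one (hζ.ne_one hp.out.one_lt)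
  set ψ := traceAddChar F hζ.pow_eq_one
  have hinv : (χ⁻¹ ^ r)⁻¹ = χ⁻¹ ^ (p ^ h - 1 - r) := by
    rw [inv_eq_iff_mul_eq_one, ← pow_add, Nat.add_sub_cancel' hr.le, ← hord, pow_orderOf_eq_one]
  have := charP_of_injective_algebraMap (algebraMap (ZMod p) F).injective p
  have hcompl : gaussSum (χ⁻¹ ^ r)⁻¹ ψ ∣ (ζ - 1) ^ (p.digits (p ^ h - 1 - r)).sum := by
    rw [hinv]
    exact (gaussSum_pow_dvd_pow_sum_digits hψ1 (traceAddChar_pow_char F _) _ _).trans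
      ((associated_gaussSum_inv_traceAddChar hζ.pow_eq_one hχ hχ1).pow_pow).dvd
  have hprod : Associated ((ζ - 1) ^ ((p - 1) * h))
      (gaussSum (χ⁻¹ ^ r) ψ * gaussSum (χ⁻¹ ^ r)⁻¹ ψ) := by
    rw [pow_mul]
    refine (associated_sub_one_pow_natCast hζ).pow_pow.trans ?_
    rw [← Nat.cast_pow, ← hF]
    exact (associated_gaussSum_mul_gaussSum_inv
      (pow_ne_one_of_lt_orderOf hr0.ne' (by rwa [hord])) hψ1).symm
  refine (mul_dvd_mul_iff_left (pow_ne_zero (p.digits (p ^ h - 1 - r)).sum hζ1)).1 ?_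
  rw [← pow_add, sum_digits_pow_sub_one_sub_add hp.out.one_lt (by lia), mul_comm _ (gaussSum _ _)]
  exact hprod.dvd.trans (mul_dvd_mul_left _ hcompl)

end LocalRing

section Fourier

variable {F : Type*} [Field F] [Fintype F] {R : Type*} [CommRing R] [IsDomain R] {χ : MulChar F R}

theorem sum_inv_pow_apply_mul_pow [DecidableEq F] (hχ : Function.Injective χ) {a : F} (ha : a ≠ 0)
    (x : F) : ∑ r ∈ range (Fintype.card F - 1), (χ⁻¹ ^ r) x * χ a ^ r =
      if x = a then (Fintype.card F : R) - 1 else 0 := by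
  rcases eq_or_ne x 0 with rfl | hx
  · simp [ha.symm, MulChar.map_zero]
  have hterm (r : ℕ) : (χ⁻¹ ^ r) x * χ a ^ r = χ (x⁻¹ * a) ^ r := by
    obtain ⟨u, rfl⟩ := hx.isUnit
    rw [MulChar.pow_apply_coe, MulChar.inv_apply', ← mul_pow, ← map_mul]
  simp_rw [hterm]
  split_ifs with hxa
  · simp [hxa, ha, Nat.cast_sub Fintype.card_pos]
  · have hne : χ (x⁻¹ * a) ≠ 1 := fun h1 =>
      hxa ((inv_mul_eq_one₀ hx).1 (hχ (h1.trans (map_one χ).symm)))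
    have hroot : χ (x⁻¹ * a) ^ (Fintype.card F - 1) = 1 := by
      rw [← map_pow, FiniteField.pow_card_sub_one_eq_one _ (by simp [hx, ha]), map_one]
    have hgeom := mul_geom_sum (χ (x⁻¹ * a)) (Fintype.card F - 1)
    rw [hroot, sub_self] at hgeom
    exact (mul_eq_zero.1 hgeom).resolve_left (sub_ne_zero.2 hne)

theorem card_sub_one_mul_addChar_eq_sum (hχ : Function.Injective χ) {ψ : AddChar F R} {a : F}
    (ha : a ≠ 0) : ((Fintype.card F : R) - 1) * ψ a =
      ∑ r ∈ range (Fintype.card F - 1), gaussSum (χ⁻¹ ^ r) ψ * χ a ^ r := by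
  classical
  simp_rw [gaussSum, sum_mul]
  rw [sum_comm]
  simp_rw [mul_right_comm _ (ψ _), ← sum_mul, sum_inv_pow_apply_mul_pow hχ ha]
  simp

/- At `a = 0` the convention `0 ^ 0 = 1` makes the `r = 0` term survive; the exponents `0` and
`|F| - 1`, which agree on nonzero `a`, are separated so that the formula holds for all `a`. -/
theorem card_sub_one_mul_addChar_eq (hχ : Function.Injective χ) {ψ : AddChar F R} (hψ : ψ ≠ 1)
    (a : F) : ((Fintype.card F : R) - 1) * ψ a =
      (Fintype.card F - 1) + ∑ r ∈ Ico 1 (Fintype.card F - 1), gaussSum (χ⁻¹ ^ r) ψ * χ a ^ r -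
        Fintype.card F * χ a ^ (Fintype.card F - 1) := by
  have hcard : 0 < Fintype.card F - 1 := Nat.sub_pos_of_lt Fintype.one_lt_card
  rcases eq_or_ne a 0 with rfl | ha
  · rw [sum_eq_zero fun r hr => by
      rw [MulChar.map_zero, zero_pow (by have := mem_Ico.1 hr; lia), mul_zero]]
    simp [MulChar.map_zero, hcard.ne']
  · rw [card_sub_one_mul_addChar_eq_sum hχ ha, range_eq_Ico, sum_eq_sum_Ico_succ_bot hcard,
      pow_zero, pow_zero, gaussSum_one_left hψ, ← map_pow,
      FiniteField.pow_card_sub_one_eq_one _ ha, map_one]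
    ring

end Fourier

section FourierLocal

open IsLocalRing

variable {p : ℕ} [hp : Fact p.Prime] {F : Type*} [Field F] [Fintype F] [Algebra (ZMod p) F]
  {R : Type*} [CommRing R] [IsDomain R] [IsLocalRing R] [CharP (ResidueField R) p] {ζ : R}
  {χ : MulChar F R} {φ : F →+* ResidueField R}

theorem exists_traceAddChar_eq_sum_mul_pow (hζ : IsPrimitiveRoot ζ p)
    (hχ : ∀ x, residue R (χ x) = φ x) {h : ℕ} (hF : Fintype.card F = p ^ h) :
    ∃ C : ℕ → R, (∀ r < p ^ h, (ζ - 1) ^ (p.digits r).sum ∣ C r) ∧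
      ∀ a, traceAddChar F hζ.pow_eq_one a = ∑ r ∈ range (p ^ h), C r * χ a ^ r := by
  have hinj := injective_of_map_apply_eq hχ
  have hψ1 := traceAddChar_ne_one F hζ.pow_eq_one (hζ.ne_one hp.out.one_lt)
  set ψ := traceAddChar F hζ.pow_eq_one
  have hone_lt : 1 < p ^ h := hF ▸ Fintype.one_lt_card
  have hh : h ≠ 0 := by rintro rfl; simp at hone_lt
  obtain ⟨u, hu⟩ : IsUnit ((p ^ h : ℕ) - 1 : R) := by
    rw [← residue_ne_zero_iff_isUnit]
    simp [hh]
  let C (r : ℕ) : R :=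
    if r = 0 then 1 else if r = p ^ h - 1 then -(↑u⁻¹ * (p ^ h : ℕ)) else
      ↑u⁻¹ * gaussSum (χ⁻¹ ^ r) ψ
  refine ⟨C, fun r hr => ?_, fun a => ?_⟩
  · unfold C
    split_ifs with hr0 hrn
    · simp [hr0]
    · have hsum : (p.digits r).sum = (p - 1) * h := by
        simpa [hrn] using sum_digits_pow_sub_one_sub_add hp.out.one_lt (pow_pos hp.out.pos h)
      rw [hsum, pow_mul, Nat.cast_pow]
      exact (((associated_sub_one_pow_natCast hζ).pow_pow.dvd).mul_left _).neg_right
    · exact (sub_one_pow_sum_digits_dvd_gaussSum hζ hχ hF (by lia) (by lia)).mul_left _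
  · have hfourier := card_sub_one_mul_addChar_eq hinj hψ1 a
    rw [hF] at hfourier
    have hmid : ∑ r ∈ Ico 1 (p ^ h - 1), C r * χ a ^ r =
        ↑u⁻¹ * ∑ r ∈ Ico 1 (p ^ h - 1), gaussSum (χ⁻¹ ^ r) ψ * χ a ^ r := by
      rw [mul_sum]
      refine sum_congr rfl fun r hr => ?_
      have := mem_Ico.1 hr
      simp only [C, if_neg (by lia : r ≠ 0), if_neg (by lia : r ≠ p ^ h - 1), mul_assoc]
    rw [← Nat.sub_add_cancel hone_lt.le, sum_range_succ, range_eq_Ico,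
      sum_eq_sum_Ico_succ_bot (by lia), hmid]
    simp only [C, if_true, if_neg (by lia : p ^ h - 1 ≠ 0)]
    refine u.isUnit.mul_left_cancel ?_
    rw [hu, hfourier, ← hu]
    linear_combination ((p ^ h : ℕ) * χ a ^ (p ^ h - 1) -
      ∑ r ∈ Ico 1 (p ^ h - 1), gaussSum (χ⁻¹ ^ r) ψ * χ a ^ r) * u.mul_inv

end FourierLocal

section Teichmuller

open Polynomial

variable {R k : Type*} [CommRing R] [IsDomain R] [Field k] {ω : R} {n : ℕ}

theorem X_pow_sub_one_eq_prod_map (π : R →+* k) (hn : 0 < n) (hω : IsPrimitiveRoot ω n) :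
    (X ^ n - 1 : k[X]) = ∏ μ ∈ nthRootsFinset n (1 : R), (X - C (π μ)) := by
  simpa [Polynomial.map_prod] using congrArg (map π) (X_pow_sub_one_eq_prod hn hω)

theorem exists_pow_eq_one_and_map_eq (π : R →+* k) (hn : 0 < n) (hω : IsPrimitiveRoot ω n)
    {y : k} (hy : y ^ n = 1) : ∃ μ, μ ^ n = 1 ∧ π μ = y := by
  have hroot := congrArg (eval y) (X_pow_sub_one_eq_prod_map π hn hω)
  simp only [eval_sub, eval_pow, eval_X, eval_one, hy, sub_self, eval_prod, eval_C] at hroot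
  obtain ⟨μ, hμ, hπμ⟩ := prod_eq_zero_iff.1 hroot.symm
  exact ⟨μ, (mem_nthRootsFinset hn 1).1 hμ, (sub_eq_zero.1 hπμ).symm⟩

variable {F : Type*} [Field F] [Fintype F]

theorem nonempty_algHom_of_isPrimitiveRoot (K : Type*) [Field K] [Algebra K F] [Algebra K k]
    (π : R →+* k) (hω : IsPrimitiveRoot ω (Fintype.card F - 1)) : Nonempty (F →ₐ[K] k) := by
  have hcard : 0 < Fintype.card F - 1 := Nat.sub_pos_of_lt Fintype.one_lt_card
  have hfactor : (X ^ Fintype.card F - X : k[X]) = X * (X ^ (Fintype.card F - 1) - 1) := by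
    rw [mul_sub_one, mul_pow_sub_one Fintype.card_ne_zero]
  refine ⟨IsSplittingField.lift F (X ^ Fintype.card F - X) ?_⟩
  simp only [Polynomial.map_sub, Polynomial.map_pow, map_X]
  rw [hfactor, X_pow_sub_one_eq_prod_map π hcard hω]
  exact Splits.X.mul (Splits.prod fun μ _ => Splits.X_sub_C _)

theorem exists_mulChar_map_apply_eq (π : R →+* k) (hω : IsPrimitiveRoot ω (Fintype.card F - 1))
    (φ : F →+* k) : ∃ χ : MulChar F R, ∀ x, π (χ x) = φ x := by
  classical
  rw [← Fintype.card_units] at hω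
  obtain ⟨g, hg⟩ := IsCyclic.exists_generator (α := Fˣ)
  obtain ⟨μ, hμ, hμg⟩ := exists_pow_eq_one_and_map_eq π Fintype.card_pos hω (y := φ g) <| by
    rw [← map_pow, ← Units.val_pow_eq_pow_val, pow_card_eq_one, Units.val_one, map_one]
  have hroot : Units.ofPowEqOne μ _ hμ Fintype.card_ne_zero ∈ rootsOfUnity (Fintype.card Fˣ) R :=
    Units.pow_ofPowEqOne hμ Fintype.card_ne_zero
  have hχg : MulChar.ofRootOfUnity hroot hg g = μ := MulChar.ofRootOfUnity_spec hroot hg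
  refine ⟨MulChar.ofRootOfUnity hroot hg, fun x => ?_⟩
  rcases eq_or_ne x 0 with rfl | hx
  · rw [MulChar.map_zero, map_zero, map_zero]
  obtain ⟨x, rfl⟩ := hx.isUnit
  obtain ⟨i, rfl⟩ := mem_powers_iff_mem_zpowers.2 (hg x)
  rw [Units.val_pow_eq_pow_val, map_pow, map_pow, map_pow, hχg, hμg]

end Teichmuller

section CharacterSums

variable {F R : Type*} [Field F] [CommRing R] [IsDomain R]

theorem sum_pow_eq_zero_of_apply_pow_ne_one {χ : MulChar F R} (s : Finset F) {c : F} (hc : c ≠ 0)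
    (hs : ∀ x ∈ s, c * x ∈ s) {u : ℕ} (hu : χ c ^ u ≠ 1) : ∑ x ∈ s, χ x ^ u = 0 := by
  classical
  have himage : s.image (c * ·) = s :=
    eq_of_subset_of_card_le (image_subset_iff.2 hs)
      (card_image_of_injective _ (mul_right_injective₀ hc)).ge
  have hshift : ∑ x ∈ s, χ x ^ u = χ c ^ u * ∑ x ∈ s, χ x ^ u := by
    conv_lhs => rw [← himage]
    rw [sum_image (mul_right_injective₀ hc).injOn, mul_sum]
    exact sum_congr rfl fun x _ => by rw [map_mul, mul_pow]
  by_contra hne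
  exact hu (mul_right_cancel₀ hne (by rw [one_mul, ← hshift]))

variable [Fintype F]

theorem sub_one_dvd_of_sum_pow_ne_zero [DecidableEq F] {χ : MulChar F R}
    (hχ : Function.Injective χ) {q u : ℕ} (hq : 0 < q) (hqF : q - 1 ∣ Fintype.card F - 1)
    (hne : ∑ c : F with c ^ q = c, χ c ^ u ≠ 0) : q - 1 ∣ u := by
  obtain ⟨g, hg⟩ := IsCyclic.exists_generator (α := Fˣ)
  have hord : orderOf g = Fintype.card F - 1 := by
    rw [orderOf_eq_card_of_forall_mem_zpowers hg, Nat.card_eq_fintype_card, Fintype.card_units]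
  have hcard : 0 < Fintype.card F - 1 := Nat.sub_pos_of_lt Fintype.one_lt_card
  obtain ⟨b, hb⟩ := hqF
  have hfix : (g ^ b) ^ q = g ^ b := by
    rw [← Nat.sub_add_cancel hq, pow_succ, ← pow_mul, mul_comm b, ← hb, ← hord,
      pow_orderOf_eq_one, one_mul]
  by_contra hdvd
  refine hne (sum_pow_eq_zero_of_apply_pow_ne_one _ (g ^ b).ne_zero (fun x hx => ?_) fun h1 => ?_)
  · rw [mem_filter] at hx ⊢
    rw [mul_pow, hx.2, ← Units.val_pow_eq_pow_val (g ^ b), hfix]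
    exact ⟨mem_univ _, rfl⟩
  · rw [← map_pow, ← Units.val_pow_eq_pow_val, ← map_one χ, ← Units.val_one] at h1
    have hpow := Units.ext (hχ h1)
    rw [← pow_mul, ← orderOf_dvd_iff_pow_eq_one, hord, hb, mul_comm] at hpow
    exact hdvd ((Nat.mul_dvd_mul_iff_left (Nat.pos_of_mul_pos_left (hb ▸ hcard))).1 hpow)

variable {ψ : AddChar F R} {p e : ℕ} [Fact p.Prime] [CharP F p]

theorem sum_addChar_mul_sub_pow [DecidableEq F] (hψ1 : ψ ≠ 1)
    (hψ : ∀ x, ψ (x ^ p ^ e) = ψ x) (c : F) :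
    ∑ y, ψ (c * (y - y ^ p ^ e)) = if c ^ p ^ e = c then (Fintype.card F : R) else 0 := by
  have hterm (y : F) :
      ψ (c * (y - y ^ p ^ e)) = ψ (iterateFrobenius F p e y * (c ^ p ^ e - c)) := by
    rw [iterateFrobenius_def, mul_sub, sub_eq_add_neg, AddChar.map_add_eq_mul, ← hψ (c * y),
      ← AddChar.map_add_eq_mul]
    congr 1
    ring
  simp_rw [hterm]
  rw [(bijective_iterateFrobenius F p e).sum_comp fun z => ψ (z * (c ^ p ^ e - c)),
    AddChar.sum_mulShift _ (AddChar.IsPrimitive.of_ne_one hψ1)]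
  simp only [sub_eq_zero, Nat.cast_ite, Nat.cast_zero]

theorem natCast_card_eq_pow_sub [DecidableEq F] (hψ1 : ψ ≠ 1) (hψ : ∀ x, ψ (x ^ p ^ e) = ψ x)
    (hF : (Fintype.card F : R) ≠ 0) {X : Type*} [Fintype X] (g : X → F) :
    (Nat.card {z : X × F // g z.1 = z.2 ^ p ^ e - z.2} : R) =
      ∑ c : F with c ^ p ^ e = c, ∑ x, ψ (c * g x) := by
  have hdetect (z : X × F) :
      (Fintype.card F : R) * (if g z.1 = z.2 ^ p ^ e - z.2 then 1 else 0) =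
        ∑ c, ψ (c * g z.1) * ψ (c * (z.2 - z.2 ^ p ^ e)) := by
    simp_rw [← AddChar.map_add_eq_mul, ← mul_add, ← neg_sub (z.2 ^ p ^ e), ← sub_eq_add_neg]
    rw [AddChar.sum_mulShift _ (AddChar.IsPrimitive.of_ne_one hψ1)]
    simp [sub_eq_zero]
  refine mul_left_cancel₀ hF ?_
  rw [Nat.card_eq_fintype_card, Fintype.card_subtype, natCast_card_filter, mul_sum,
    sum_congr rfl fun z _ => hdetect z, sum_comm, mul_sum, sum_filter]
  refine sum_congr rfl fun c _ => ?_
  simp_rw [Fintype.sum_prod_type, ← mul_sum, sum_addChar_mul_sub_pow hψ1 hψ, ← sum_mul]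
  split_ifs
  · rw [mul_comm]
  · rw [mul_zero]

end CharacterSums

section Expansion

theorem addChar_sum_eq_prod {A M ι : Type*} [AddCommMonoid A] [CommMonoid M] (ψ : AddChar A M)
    (s : Finset ι) (f : ι → A) : ψ (∑ i ∈ s, f i) = ∏ i ∈ s, ψ (f i) :=
  map_prod ψ.toMonoidHom (fun i => Multiplicative.ofAdd (f i)) s

variable {F R σ : Type*} [Field F] [Fintype F] [CommRing R] [Fintype σ]

theorem pow_dvd_prod_sum_pow (χ : MulChar F R) {a : R} {m : ℕ} (ha : a ^ m ∣ (Fintype.card F : R))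
    (u : σ → ℕ) : a ^ (m * #{l | u l = 0}) ∣ ∏ l, ∑ y, χ y ^ u l := by
  rw [pow_mul, ← prod_const, prod_filter]
  refine prod_dvd_prod_of_dvd _ _ fun l _ => ?_
  split_ifs with hu
  · simpa [hu] using ha
  · exact one_dvd _

variable {ψ : AddChar F R} {χ : MulChar F R} {C : ℕ → R} {n : ℕ} {I : Type*} [Fintype I]
  [DecidableEq I] [DecidableEq σ]

theorem sum_addChar_mul_sum_monomial (hC : ∀ a, ψ a = ∑ r ∈ range n, C r * χ a ^ r) (a : I → F)
    (D : I → σ → ℕ) (s : Finset F) :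
    ∑ c ∈ s, ∑ x : σ → F, ψ (c * ∑ i, a i * ∏ l, x l ^ D i l) =
      ∑ r ∈ Fintype.piFinset fun _ : I => range n, (∏ i, C (r i) * χ (a i) ^ r i) *
        (∑ c ∈ s, χ c ^ ∑ i, r i) * ∏ l, ∑ y, χ y ^ ∑ i, D i l * r i := by
  have hexpand (c : F) (x : σ → F) : ψ (c * ∑ i, a i * ∏ l, x l ^ D i l) =
      ∑ r ∈ Fintype.piFinset fun _ : I => range n, (∏ i, C (r i) * χ (a i) ^ r i) *
        (χ c ^ ∑ i, r i) * ∏ l, χ (x l) ^ ∑ i, D i l * r i := by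
    rw [mul_sum, addChar_sum_eq_prod]
    simp_rw [hC]
    rw [prod_univ_sum]
    refine sum_congr rfl fun r _ => ?_
    simp_rw [← prod_pow_eq_pow_sum]
    rw [prod_comm, ← prod_mul_distrib, ← prod_mul_distrib]
    refine prod_congr rfl fun i _ => ?_
    simp_rw [map_mul, map_prod, map_pow, mul_pow, ← prod_pow, ← pow_mul]
    ring
  simp_rw [hexpand, sum_comm (s := univ) (t := Fintype.piFinset _)]
  rw [sum_comm]
  refine sum_congr rfl fun r _ => ?_
  rw [prod_univ_sum, Fintype.piFinset_univ]
  simp_rw [← mul_sum, ← sum_mul, ← mul_sum]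

end Expansion

theorem pow_dvd_expansion_term {p e h d : ℕ} [hp : Fact p.Prime] {F R I σ : Type*} [Field F]
    [Fintype F] [DecidableEq F] [CommRing R] [IsDomain R] [Fintype I] [Fintype σ]
    {χ : MulChar F R} (hχ : Function.Injective χ) (hF : Fintype.card F = p ^ h)
    (hQ : p ^ e - 1 ∣ p ^ h - 1) {b : R} (hb : b ^ ((p - 1) * h) ∣ (Fintype.card F : R)) {C : ℕ → R}
    (hC : ∀ r < p ^ h, b ^ (p.digits r).sum ∣ C r) {D : I → σ → ℕ} (hd : 0 < d)
    (hD : ∀ i, ∑ l, D i l ≤ d) (a : I → F) {r : I → ℕ} (hr : ∀ i, r i < p ^ h) :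
    b ^ ((p - 1) * (h * ((p ^ e - 1) *
      (Fintype.card σ * (p ^ h - 1) ⌈/⌉ (d * (p ^ e - 1))))) ⌈/⌉ (p ^ h - 1)) ∣
      (∏ i, C (r i) * χ (a i) ^ r i) * (∑ c : F with c ^ p ^ e = c, χ c ^ ∑ i, r i) *
        ∏ l, ∑ y, χ y ^ ∑ i, D i l * r i := by
  rcases eq_or_ne (∑ c : F with c ^ p ^ e = c, χ c ^ ∑ i, r i) 0 with hzero | hne
  · simp [hzero]
  rcases eq_or_ne (∏ l, ∑ y, χ y ^ ∑ i, D i l * r i) 0 with hzero | hne'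
  · simp [hzero]
  have hQr : p ^ e - 1 ∣ ∑ i, r i :=
    sub_one_dvd_of_sum_pow_ne_zero hχ (pow_pos hp.out.pos e) (by rwa [hF]) hne
  have hdvd (l : σ) : p ^ h - 1 ∣ ∑ i, D i l * r i := by
    rw [← hF]
    refine sub_one_dvd_of_sum_pow_ne_zero hχ Fintype.card_pos dvd_rfl ?_
    simpa [FiniteField.pow_card] using prod_ne_zero_iff.1 hne' l (mem_univ l)
  have hn : 0 < p ^ h - 1 := by
    rw [← hF]
    exact Nat.sub_pos_of_lt Fintype.one_lt_card
  refine (pow_dvd_pow b ((ceilDiv_le_iff_le_mul hn).2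
    (mul_ceilDiv_le_mul_sum_digits_add_card_mul hp.out.one_lt hd hD hr hQ hQr hdvd))).trans ?_
  rw [pow_add, ← prod_pow_eq_pow_sum]
  exact mul_dvd_mul ((prod_dvd_prod_of_dvd _ _ fun i _ => (hC _ (hr i)).mul_right _).mul_right _)
    (pow_dvd_prod_sum_pow χ hb _)

section Divisibility

open IsLocalRing

variable {p : ℕ} {R : Type*} [CommRing R] [IsLocalRing R] [CharP (ResidueField R) p]

theorem isUnit_natCast_of_not_dvd {a : ℕ} (ha : ¬ p ∣ a) : IsUnit (a : R) := by
  rwa [← residue_ne_zero_iff_isUnit, map_natCast, Ne, CharP.cast_eq_zero_iff _ p]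

variable [hp : Fact p.Prime] [IsDomain R] {ζ : R}

theorem le_of_sub_one_pow_dvd_natCast (hζ : IsPrimitiveRoot ζ p) {N v B : ℕ}
    (hv : emultiplicity p N = v) (hB : (ζ - 1) ^ B ∣ (N : R)) : B ≤ (p - 1) * v := by
  obtain ⟨⟨a, rfl⟩, hndvd⟩ := emultiplicity_eq_coe.1 hv
  have ha : IsUnit (a : R) := isUnit_natCast_of_not_dvd (p := p) fun hpa =>
    hndvd (pow_succ p v ▸ mul_dvd_mul_left _ hpa)
  have hassoc := associated_sub_one_pow_natCast hζ
  have hp_not_unit : ¬ IsUnit (p : R) := by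
    rw [← residue_ne_zero_iff_isUnit]
    simp
  refine (pow_dvd_pow_iff (sub_ne_zero.2 (hζ.ne_one hp.out.one_lt)) fun hunit =>
    hp_not_unit (hassoc.isUnit (hunit.pow _))).1 ?_
  rw [Nat.cast_mul, ha.dvd_mul_right, Nat.cast_pow] at hB
  rw [pow_mul]
  exact hB.trans hassoc.symm.pow_pow.dvd

variable {F : Type*} [Field F] [Fintype F] [Algebra (ZMod p) F] {χ : MulChar F R}
  {φ : F →+* ResidueField R}

theorem sub_one_pow_dvd_card_solutions (hζ : IsPrimitiveRoot ζ p)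
    (hχ : ∀ x, residue R (χ x) = φ x) {e h d : ℕ} (hF : Fintype.card F = p ^ h)
    (hQ : p ^ e - 1 ∣ p ^ h - 1) {σ : Type*} [Fintype σ] {f : MvPolynomial σ F} (hd : 0 < d)
    (hf : f.totalDegree ≤ d) :
    (ζ - 1) ^ ((p - 1) * (h * ((p ^ e - 1) *
      (Fintype.card σ * (p ^ h - 1) ⌈/⌉ (d * (p ^ e - 1))))) ⌈/⌉ (p ^ h - 1)) ∣
      (Nat.card {z : (σ → F) × F // MvPolynomial.eval z.1 f = z.2 ^ p ^ e - z.2} : R) := by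
  classical
  have := charP_of_injective_algebraMap (algebraMap (ZMod p) F).injective p
  have hinj := injective_of_map_apply_eq hχ
  have hcard : (ζ - 1) ^ ((p - 1) * h) ∣ (Fintype.card F : R) := by
    rw [pow_mul, hF, Nat.cast_pow]
    exact (associated_sub_one_pow_natCast hζ).pow_pow.dvd
  have hcard_ne : (Fintype.card F : R) ≠ 0 := by
    rw [hF, Nat.cast_pow]
    exact pow_ne_zero _ ((associated_sub_one_pow_natCast hζ).ne_zero_iff.1
      (pow_ne_zero _ (sub_ne_zero.2 (hζ.ne_one hp.out.one_lt))))
  obtain ⟨C, hCdvd, hC⟩ := exists_traceAddChar_eq_sum_mul_pow hζ hχ hF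
  have hD (i : f.support) : ∑ l, (i : σ →₀ ℕ) l ≤ d := by
    refine le_trans (le_of_eq ?_) ((MvPolynomial.le_totalDegree i.2).trans hf)
    rw [Finsupp.sum_fintype _ _ fun _ => rfl]
  rw [natCast_card_eq_pow_sub (traceAddChar_ne_one F hζ.pow_eq_one (hζ.ne_one hp.out.one_lt))
    (traceAddChar_pow_char_pow F hζ.pow_eq_one e) hcard_ne fun x => MvPolynomial.eval x f]
  simp_rw [MvPolynomial.eval_eq', ← sum_coe_sort f.support]
  rw [sum_addChar_mul_sum_monomial hC]
  exact dvd_sum fun r hr => pow_dvd_expansion_term hinj hF hQ hcard hCdvd hd hD _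
    fun i => mem_range.1 (Fintype.mem_piFinset.1 hr i)

end Divisibility

section PadicComplexIntegers

open IsLocalRing

variable {p : ℕ} [hp : Fact p.Prime]

theorem charP_residueField_padicComplexInt : CharP (ResidueField 𝓞_ℂ_[p]) p := by
  refine ringChar.of_eq (CharP.ringChar_of_prime_eq_zero hp.out ?_)
  rw [← map_natCast (residue 𝓞_ℂ_[p]), residue_eq_zero_iff]
  refine (Valuation.mem_maximalIdeal_iff _ _).2 (?_ : Valued.v (p : ℂ_[p]) < 1)
  rw [PadicComplex.valuation_p, one_div]
  exact inv_lt_one_of_one_lt₀ (Nat.one_lt_cast.2 hp.out.one_lt)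

theorem exists_isPrimitiveRoot_padicComplexInt (n : ℕ) [NeZero n] :
    ∃ ω : 𝓞_ℂ_[p], IsPrimitiveRoot ω n := by
  obtain ⟨ω, hω⟩ := HasEnoughRootsOfUnity.exists_primitiveRoot ℂ_[p] n
  have hval : Valued.v ω = 1 := by
    rw [← pow_eq_one_iff_of_nonneg zero_le (NeZero.ne n), ← map_pow, hω.pow_eq_one, map_one]
  exact ⟨⟨ω, hval.le⟩, IsPrimitiveRoot.of_map_of_injective
    (f := 𝓞_ℂ_[p].subtype) hω Subtype.val_injective⟩

end PadicComplexIntegers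

section Main

open IsLocalRing

variable {p e h d v : ℕ} {F σ : Type*} [Field F] [Finite F] [Finite σ]

theorem mul_ceilDiv_le_mul_of_emultiplicity_card_eq (hp : p.Prime) (hF : Nat.card F = p ^ h)
    (hQ : p ^ e - 1 ∣ p ^ h - 1) {f : MvPolynomial σ F} (hd : 0 < d) (hf : f.totalDegree ≤ d)
    (hv : emultiplicity p
      (Nat.card {z : (σ → F) × F // MvPolynomial.eval z.1 f = z.2 ^ p ^ e - z.2}) = v) :
    h * ((p ^ e - 1) * (Nat.card σ * (p ^ h - 1) ⌈/⌉ (d * (p ^ e - 1)))) ≤ (p ^ h - 1) * v := by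
  have := Fintype.ofFinite F
  have := Fintype.ofFinite σ
  have : Fact p.Prime := ⟨hp⟩
  rw [Nat.card_eq_fintype_card] at hF ⊢
  have := charP_of_card_eq_prime_pow hF
  have := charP_residueField_padicComplexInt (p := p)
  let _ := ZMod.algebra F p
  let _ := ZMod.algebra (ResidueField 𝓞_ℂ_[p]) p
  have hcard : 0 < Fintype.card F - 1 := Nat.sub_pos_of_lt Fintype.one_lt_card
  have : NeZero (Fintype.card F - 1) := ⟨hcard.ne'⟩
  obtain ⟨ζ, hζ⟩ := exists_isPrimitiveRoot_padicComplexInt (p := p) p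
  obtain ⟨ω, hω⟩ := exists_isPrimitiveRoot_padicComplexInt (p := p) (Fintype.card F - 1)
  obtain ⟨φ⟩ := nonempty_algHom_of_isPrimitiveRoot (ZMod p) (residue _) hω
  obtain ⟨χ, hχ⟩ := exists_mulChar_map_apply_eq (residue _) hω φ.toRingHom
  have hle := le_of_sub_one_pow_dvd_natCast hζ hv
    (sub_one_pow_dvd_card_solutions hζ hχ hF hQ hd hf)
  rw [ceilDiv_le_iff_le_mul (hF ▸ hcard), mul_left_comm (p ^ h - 1)] at hle
  exact Nat.le_of_mul_le_mul_left hle (Nat.sub_pos_of_lt hp.one_lt)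

theorem natCeil_natCast_div {K : Type*} [Field K] [LinearOrder K] [IsStrictOrderedRing K]
    [FloorSemiring K] (a : ℕ) {b : ℕ} (hb : 0 < b) : ⌈(a / b : K)⌉₊ = a ⌈/⌉ b := by
  refine eq_of_forall_ge_iff fun c => ?_
  rw [Nat.ceil_le, ceilDiv_le_iff_le_mul hb, div_le_iff₀ (Nat.cast_pos.2 hb), mul_comm]
  exact_mod_cast Iff.rfl

end Main

end Development

/-- `F` is the field with `q ^ m` elements, `q = p ^ e`. The `p`-adic valuation is
`emultiplicity p`, with values in `ℕ∞` and `⊤` at `0`. -/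
theorem mainTheorem5 (p e m q k d : ℕ) (hp : p.Prime) (he : 1 ≤ e) (hm : 1 ≤ m)
    (hq : q = p ^ e) {F : Type*} [Field F] [Finite F] (hF : Nat.card F = q ^ m)
    (f : MvPolynomial (Fin k) F) (hd : 1 ≤ d) (hf : f.totalDegree = d) :
    ((⌈((e : ℚ) * m * (q - 1)) / ((q : ℚ) ^ m - 1) *
        (⌈((k : ℚ) * ((q : ℚ) ^ m - 1)) / (d * (q - 1))⌉₊ : ℚ)⌉₊ : ℕ) : ℕ∞) ≤
      emultiplicity p (artinSchreierCount f q) := by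
  subst hq
  have hq1 : 1 < p ^ e := Nat.one_lt_pow (by lia) hp.one_lt
  have hn : 0 < p ^ (e * m) - 1 := Nat.sub_pos_of_lt (Nat.one_lt_pow (by positivity) hp.one_lt)
  have hdQ : 0 < d * (p ^ e - 1) := Nat.mul_pos hd (Nat.sub_pos_of_lt hq1)
  have hQ : p ^ e - 1 ∣ p ^ (e * m) - 1 := pow_mul p e m ▸ Nat.sub_one_dvd_pow_sub_one _ _
  have hcast_sub : ((p ^ e : ℕ) : ℚ) - 1 = (p ^ e - 1 : ℕ) := (Nat.cast_pred (by lia)).symm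
  have hcast_pow_sub : ((p ^ e : ℕ) : ℚ) ^ m - 1 = (p ^ (e * m) - 1 : ℕ) := by
    rw [Nat.cast_pred (by lia), pow_mul, Nat.cast_pow (p ^ e)]
  rw [hcast_sub, hcast_pow_sub]
  norm_cast
  rw [natCeil_natCast_div _ hdQ, div_mul_eq_mul_div]
  norm_cast
  rw [natCeil_natCast_div _ hn]
  rcases eq_or_ne (emultiplicity p (artinSchreierCount f (p ^ e))) ⊤ with htop | hfin
  · exact htop ▸ le_top
  obtain ⟨v, hv⟩ := ENat.ne_top_iff_exists.1 hfin
  rw [← hv, Nat.cast_le, ceilDiv_le_iff_le_mul hn, mul_assoc]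
  simpa using
    mul_ceilDiv_le_mul_of_emultiplicity_card_eq hp (pow_mul p e m ▸ hF) hQ hd hf.le hv.symm
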